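/- Let $n\ge 1$, let $M$ be a smooth manifold, and let $\vartheta\colon M\times G\to M$ be a smooth right action of a compact connected Lie group $G$ on $M$; write $\vartheta_g=\vartheta(\cdot,g)$. Let $\omega\in\Omega^{n+1}(M)$ satisfy $\vartheta_g^*\omega=\omega$ for all $g\in G$, and let $v$ be a smooth vector field on $M$ that is $G$-invariant, i.e. $(\vartheta_g)_*v=v$ for all $g\in G$, with $\mathcal{L}_v\omega=0$. Suppose that $H^n_{dR}(M)=0$. (1) If $\omega$ is closed (i.e. $(M,\omega)$ is a pre-$n$-plectic manifold), then $v$ is a Hamiltonian vector field of some $G$-invariant Hamiltonian form: there is $H\in\Omega^{n-1}(M)$ with $dH=-\iota_v\omega$ and $\vartheta_g^*H=H$ for all $g\in G$. Moreover $H$ is strictly preserved by the action, i.e. $\mathcal{L}_{v_x}H=0$ for every $x$ in the Lie algebra $\mathfrak g$ of $G$, where $v_x(m)=\frac{d}{dt}\big|_{0}\vartheta(m,\exp(tx))$. (2) In particular, if $\omega$ is a volume form, i.e. $\dim M=n+1$ and $\omega$ vanishes nowhere (so that the cohomological assumption reads $H^{\dim M-1}_{dR}(M)=0$, and $\mathcal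 L_v\omega=0$ says that $v$ is divergence-free), then the same conclusion holds: there is $H\in\Omega^{n-1}(M)$ with $dH=-\iota_v\omega$, $\vartheta_g^*H=H$ for all $g\in G$, and $\mathcal{L}_{v_x}H=0$ for all $x\in\mathfrak g$. -/

import Mathlib

open scoped Manifold ContDiff Topology

noncomputable section

namespace Multisymplectic

section Forms

variable {E : Type*} [NormedAddCommGroup E] [NormedSpace ℝ E]
  {M : Type*} [TopologicalSpace M] [ChartedSpace E M]

variable (E M) in
/-- Sections of `Λᵏ T*M`, with no smoothness condition. -/
abbrev FormField (k : ℕ) : Type _ :=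
  ∀ x : M, TangentSpace 𝓘(ℝ, E) x [⋀^Fin k]→L[ℝ] ℝ

variable (E M) in
/-- Sections of `TM`, with no smoothness condition. -/
abbrev VecField : Type _ := ∀ x : M, TangentSpace 𝓘(ℝ, E) x

/- The tangent space of `M` at a point is by definition a copy of the model space `E`. The next three
definitions only record values of forms, values of vector fields and differentials of maps with
their types in terms of `E`. -/

/-- The value of a form at a point. -/
def formAt {k : ℕ} (Ω : FormField E M k) (x : M) : E [⋀^Fin k]→L[ℝ] ℝ := Ω x

/-- The value of a vector field at a point. -/
def vecAt (v : VecField E M) (x : M) : E := v x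

/-- The differential of a map at a point. -/
def diffAt {E' : Type*} [NormedAddCommGroup E'] [NormedSpace ℝ E']
    {N : Type*} [TopologicalSpace N] [ChartedSpace E' N] (f : M → N) (x : M) : E →L[ℝ] E' :=
  mfderiv 𝓘(ℝ, E) 𝓘(ℝ, E') f x

/-- The coordinate expression of a form in the preferred chart at `x₀`: its pullback under the
inverse of that chart. It is meaningful on the target of the chart. -/
def formInChart {k : ℕ} (Ω : FormField E M k) (x₀ : M) (y : E) : E [⋀^Fin k]→L[ℝ] ℝ :=
  (formAt Ω ((extChartAt 𝓘(ℝ, E) x₀).symm y)).compContinuousLinearMap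
    (diffAt (extChartAt 𝓘(ℝ, E) x₀).symm y)

/-- A vector field on `M` in the preferred chart at `x₀`. -/
def vecInChart (v : VecField E M) (x₀ : M) : E → E :=
  VectorField.mpullback 𝓘(ℝ, E) 𝓘(ℝ, E) (extChartAt 𝓘(ℝ, E) x₀).symm v

/-- Transport of an alternating form on the model space at the image of `x` in the preferred chart
at `x` to the tangent space at `x`. -/
def formFromChart {k : ℕ} (x : M) (α : E [⋀^Fin k]→L[ℝ] ℝ) :
    TangentSpace 𝓘(ℝ, E) x [⋀^Fin k]→L[ℝ] ℝ :=
  α.compContinuousLinearMap (diffAt (E := E) (extChartAt 𝓘(ℝ, E) x) x)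

/-- The exterior derivative. -/
def extD {k : ℕ} (Ω : FormField E M k) : FormField E M (k + 1) := fun x =>
  formFromChart x (extDeriv (formInChart Ω x) (extChartAt 𝓘(ℝ, E) x x))

/-- The Lie derivative of a form on a normed space along a vector field,
`(L_v Ω)_x (w₁, …, w_k) = (D_{v(x)} Ω)_x (w₁, …, w_k) + ∑ i, Ω_x (w₁, …, Dv_x (w_i), …, w_k)`. -/
def lieDerivModel {k : ℕ} (v : E → E) (Ω : E → E [⋀^Fin k]→L[ℝ] ℝ) (x : E) :
    E [⋀^Fin k]→L[ℝ] ℝ :=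
  fderiv ℝ Ω x (v x) +
    (Ω x).fderivCompContinuousLinearMap (ContinuousLinearMap.id ℝ E) (fderiv ℝ v x)

theorem lieDerivModel_apply {k : ℕ} (v : E → E) (Ω : E → E [⋀^Fin k]→L[ℝ] ℝ) (x : E)
    (w : Fin k → E) :
    lieDerivModel v Ω x w =
      fderiv ℝ Ω x (v x) w + ∑ i, Ω x (Function.update w i (fderiv ℝ v x (w i))) := by
  simp only [lieDerivModel, ContinuousAlternatingMap.add_apply,
    ContinuousAlternatingMap.fderivCompContinuousLinearMap_apply]
  congr 1
  refine Finset.sum_congr rfl fun i _ => congrArg _ (funext fun j => ?_)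
  by_cases h : j = i
  · subst h; simp
  · simp [h]

/-- The Lie derivative of a form along a vector field, computed in charts. -/
def lieD {k : ℕ} (v : VecField E M) (Ω : FormField E M k) : FormField E M k := fun x =>
  formFromChart x
    (lieDerivModel (vecInChart v x) (formInChart Ω x) (extChartAt 𝓘(ℝ, E) x x))

/-- The contraction `ι_v Ω = Ω(v, ·, …, ·)`. -/
def contract {k : ℕ} (v : VecField E M) (Ω : FormField E M (k + 1)) : FormField E M k := fun x =>
  (formAt Ω x).curryLeft (vecAt v x)

/-- The pullback `f^* Ω` of a form under a map `f : M → M`. -/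
def pullbackForm {k : ℕ} (f : M → M) (Ω : FormField E M k) : FormField E M k := fun x =>
  (Ω (f x)).compContinuousLinearMap (mfderiv 𝓘(ℝ, E) 𝓘(ℝ, E) f x)

/-- A form is smooth if its coordinate expressions are. -/
def IsSmoothForm {k : ℕ} (Ω : FormField E M k) : Prop :=
  ∀ x₀ : M, ContDiffOn ℝ ∞ (formInChart Ω x₀) (extChartAt 𝓘(ℝ, E) x₀).target

/-- Smooth vector fields. -/
def IsSmoothVecField [IsManifold 𝓘(ℝ, E) ∞ M] (v : VecField E M) : Prop :=
  ContMDiff 𝓘(ℝ, E) 𝓘(ℝ, E).tangent ∞ (fun x => (⟨x, v x⟩ : TangentBundle 𝓘(ℝ, E) M))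

theorem formInChart_add {k : ℕ} (Ω η : FormField E M k) (x₀ : M) :
    formInChart (Ω + η) x₀ = formInChart Ω x₀ + formInChart η x₀ := rfl

theorem formInChart_smul {k : ℕ} (c : ℝ) (Ω : FormField E M k) (x₀ : M) :
    formInChart (c • Ω) x₀ = c • formInChart Ω x₀ := rfl

theorem IsSmoothForm.differentiableAt {k : ℕ} {Ω : FormField E M k} (h : IsSmoothForm Ω) (x : M) :
    DifferentiableAt ℝ (formInChart Ω x) (extChartAt 𝓘(ℝ, E) x x) :=
  ((h x).contDiffAt (extChartAt_target_mem_nhds x)).differentiableAt (by simp)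

theorem extD_add {k : ℕ} {Ω η : FormField E M k} (hΩ : IsSmoothForm Ω) (hη : IsSmoothForm η) :
    extD (Ω + η) = extD Ω + extD η := by
  funext x
  simp only [extD, formInChart_add, Pi.add_apply,
    extDeriv_add (hΩ.differentiableAt x) (hη.differentiableAt x)]
  rfl

theorem extD_smul {k : ℕ} (c : ℝ) (Ω : FormField E M k) : extD (c • Ω) = c • extD Ω := by
  funext x
  simp only [extD, formInChart_smul, Pi.smul_apply, extDeriv_smul]
  rfl

theorem isSmoothForm_zero {k : ℕ} : IsSmoothForm (0 : FormField E M k) := fun _ =>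
  contDiffOn_const (c := (0 : E [⋀^Fin k]→L[ℝ] ℝ))

theorem extD_zero {k : ℕ} : extD (0 : FormField E M k) = 0 := by
  simpa using extD_smul (0 : ℝ) (0 : FormField E M k)

variable (E M) in
/-- Closed smooth `k`-forms. -/
def closedForms (k : ℕ) : Submodule ℝ (FormField E M k) where
  carrier := {Ω | IsSmoothForm Ω ∧ extD Ω = 0}
  zero_mem' := ⟨isSmoothForm_zero, extD_zero⟩
  add_mem' {Ω η} hΩ hη :=
    ⟨fun x => (hΩ.1 x).add (hη.1 x), by rw [extD_add hΩ.1 hη.1, hΩ.2, hη.2, add_zero]⟩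
  smul_mem' c Ω hΩ := ⟨fun x => (hΩ.1 x).const_smul c, by rw [extD_smul, hΩ.2, smul_zero]⟩

variable (E M) in
/-- Exact smooth `k`-forms, i.e. smooth forms that are the exterior derivative of a smooth form;
in degree `0` only the zero form is exact. -/
def exactForms : (k : ℕ) → Submodule ℝ (FormField E M k)
  | 0 => ⊥
  | k + 1 =>
    { carrier := {Ω | IsSmoothForm Ω ∧ ∃ η : FormField E M k, IsSmoothForm η ∧ extD η = Ω}
      zero_mem' := ⟨isSmoothForm_zero, 0, isSmoothForm_zero, extD_zero⟩
      add_mem' := by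
        rintro Ω Ω' ⟨hΩ, η, hη, rfl⟩ ⟨hΩ', η', hη', rfl⟩
        exact ⟨fun x => (hΩ x).add (hΩ' x), η + η', fun x => (hη x).add (hη' x), extD_add hη hη'⟩
      smul_mem' := by
        rintro c Ω ⟨hΩ, η, hη, rfl⟩
        exact ⟨fun x => (hΩ x).const_smul c, c • η, fun x => (hη x).const_smul c, extD_smul c η⟩ }

instance closedForms.instAddCommGroup (k : ℕ) : AddCommGroup (closedForms E M k) :=
  Submodule.addCommGroup (R := ℝ) (M := FormField E M k) _

variable (E M) in
/-- De Rham cohomology in degree `k`: closed forms modulo exact forms. -/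
abbrev DeRhamCohomology (k : ℕ) : Type _ :=
  closedForms E M k ⧸ (exactForms E M k).submoduleOf (closedForms E M k)

/-- `Ω` is a pre-`n`-plectic form for `n = k + 1`: a closed smooth form of degree `n + 1`. -/
def IsPrePlectic {k : ℕ} (Ω : FormField E M (k + 2)) : Prop :=
  IsSmoothForm Ω ∧ extD Ω = 0

/-- `Ω` is a volume form: a nowhere vanishing smooth form of top degree. -/
def IsVolumeForm {m : ℕ} (Ω : FormField E M m) : Prop :=
  Module.finrank ℝ E = m ∧ IsSmoothForm Ω ∧ ∀ x, Ω x ≠ 0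

/-- `v` is a Hamiltonian vector field of the `(n-1)`-form `H` with respect to the `(n+1)`-form `Ω`,
where `n = k + 1`: both are smooth and `dH = - ι_v Ω`. -/
def IsHamiltonianVecField [IsManifold 𝓘(ℝ, E) ∞ M] {k : ℕ} (Ω : FormField E M (k + 2)) (H : FormField E M k)
    (v : VecField E M) : Prop :=
  IsSmoothForm H ∧ IsSmoothVecField v ∧ extD H = -contract v Ω

end Forms

section Actions

variable {E : Type*} [NormedAddCommGroup E] [NormedSpace ℝ E]
  {M : Type*} [TopologicalSpace M] [ChartedSpace E M]
  {F : Type*} [NormedAddCommGroup F] [NormedSpace ℝ F]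
  {G : Type*} [TopologicalSpace G] [ChartedSpace F G] [Group G]

variable (E F) in
/-- `θ : M × G → M` is a smooth right action of `G` on `M`. -/
structure IsSmoothRightAction (θ : M × G → M) : Prop where
  contMDiff : ContMDiff (𝓘(ℝ, E).prod 𝓘(ℝ, F)) 𝓘(ℝ, E) ∞ θ
  map_one : ∀ x, θ (x, 1) = x
  map_mul : ∀ x g h, θ (x, g * h) = θ (θ (x, g), h)

/-- `θ_g^* Ω = Ω` for all `g`. -/
def IsInvariantForm {k : ℕ} (θ : M × G → M) (Ω : FormField E M k) : Prop :=
  ∀ g : G, pullbackForm (fun x => θ (x, g)) Ω = Ω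

/-- `(θ_g)_* v = v` for all `g`. -/
def IsInvariantVecField (θ : M × G → M) (v : VecField E M) : Prop :=
  ∀ (g : G) (x : M),
    mfderiv 𝓘(ℝ, E) 𝓘(ℝ, E) (fun y => θ (y, g)) x (v x) = v (θ (x, g))

/-- The infinitesimal generator of a right action in the direction of an element `ξ` of the Lie
algebra, the value at `x` being the image of `ξ` under the differential at `1` of the orbit map
`g ↦ θ (x, g)`. That value lies in the tangent space at `θ (x, 1)`, and `θ (x, 1) = x`. -/
def generator (θ : M × G → M) (ξ : GroupLieAlgebra 𝓘(ℝ, F) G) : VecField E M := fun x =>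
  mfderiv 𝓘(ℝ, F) 𝓘(ℝ, E) (fun g => θ (x, g)) 1 ξ

variable (F) in
/-- The action strictly preserves `H`: the Lie derivatives of `H` along all infinitesimal generators
vanish. -/
def IsStrictlyPreserved {k : ℕ} (θ : M × G → M) (H : FormField E M k) : Prop :=
  ∀ ξ : GroupLieAlgebra 𝓘(ℝ, F) G, lieD (generator θ ξ) H = 0

end Actions

end Multisymplectic

end

/-!
By Cartan's formula, `d (ι_v Ω) = L_v Ω - ι_v dΩ = 0`, and `ι_v Ω` is invariant because `Ω` and `v`
are. The vanishing of the cohomology gives a primitive `η` of `-ι_v Ω`. Averaging the pullbacks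
`θ_g^* η` against the Haar probability measure commutes with `d`, hence yields an invariant form `H`
with `dH = -ι_v Ω`. Differentiating `θ_g^* H = H` at `g = 1` in the direction `ξ` gives
`L_{v_ξ} H = 0`, since the mixed partial derivatives of the action in charts commute. A volume form
is closed, as forms of degree larger than the dimension vanish.
-/

noncomputable section

namespace Multisymplectic

open Filter MeasureTheory Set

set_option maxSynthPendingDepth 3

section AlternatingMaps

variable {𝕜 V V' W : Type*} [NontriviallyNormedField 𝕜] [NormedAddCommGroup V] [NormedSpace 𝕜 V]
  [NormedAddCommGroup V'] [NormedSpace 𝕜 V'] [NormedAddCommGroup W] [NormedSpace 𝕜 W]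

variable (𝕜 V W) in
/-- `ContinuousAlternatingMap.curryLeftLI` as a continuous linear map, the form in which the chain
rule applies to contractions. -/
def curryLeftCLM (k : ℕ) : (V [⋀^Fin (k + 1)]→L[𝕜] W) →L[𝕜] V →L[𝕜] V [⋀^Fin k]→L[𝕜] W :=
  ContinuousAlternatingMap.curryLeftLI.toContinuousLinearMap

theorem alternatizeUncurryFin_compContinuousLinearMapCLM_comp_curryLeft {k : ℕ}
    (α : V' [⋀^Fin (k + 1)]→L[𝕜] W) (A : V →L[𝕜] V') :
    ContinuousAlternatingMap.alternatizeUncurryFin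
        (ContinuousAlternatingMap.compContinuousLinearMapCLM A ∘L α.curryLeft ∘L A) =
      (k + 1) • α.compContinuousLinearMap A := by
  rw [← ContinuousAlternatingMap.alternatizeUncurryFin_curryLeft]
  congr 1
  ext u : 1
  exact (α.curryLeft_compContinuousLinearMap A u).symm

variable [CharZero 𝕜]

-- Division by `k + 1` expresses the pullback of `(k + 1)`-forms through that of `k`-forms.
theorem contDiff_compContinuousLinearMapCLM {n : ℕ∞ω} (k : ℕ) :
    ContDiff 𝕜 n fun A : V →L[𝕜] V' =>
      (ContinuousAlternatingMap.compContinuousLinearMapCLM A :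
        (V' [⋀^Fin k]→L[𝕜] W) →L[𝕜] V [⋀^Fin k]→L[𝕜] W) := by
  induction k with
  | zero =>
    have compCLM_eq_zero (A : V →L[𝕜] V') :
        (ContinuousAlternatingMap.compContinuousLinearMapCLM A :
          (V' [⋀^Fin 0]→L[𝕜] W) →L[𝕜] V [⋀^Fin 0]→L[𝕜] W) =
        ContinuousAlternatingMap.compContinuousLinearMapCLM 0 := by
      ext α w
      exact congrArg α (Subsingleton.elim _ _)
    simp only [compCLM_eq_zero, contDiff_const]
  | succ k ih =>
    have smooth_rhs : ContDiff 𝕜 n fun A : V →L[𝕜] V' => (k + 1 : 𝕜)⁻¹ •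
        (ContinuousAlternatingMap.alternatizeUncurryFinCLM 𝕜 V W ∘L
          ContinuousLinearMap.compL 𝕜 V (V' [⋀^Fin k]→L[𝕜] W) (V [⋀^Fin k]→L[𝕜] W)
            (ContinuousAlternatingMap.compContinuousLinearMapCLM A) ∘L
          (ContinuousLinearMap.compL 𝕜 V V' (V' [⋀^Fin k]→L[𝕜] W)).flip A ∘L
          curryLeftCLM 𝕜 V' W k) :=
      (contDiff_const.clm_comp (((ContinuousLinearMap.compL 𝕜 V (V' [⋀^Fin k]→L[𝕜] W)
        (V [⋀^Fin k]→L[𝕜] W)).contDiff.comp ih).clm_comp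
          ((ContinuousLinearMap.contDiff _).clm_comp contDiff_const))).const_smul _
    convert smooth_rhs with A
    ext1 α
    have hk : (k + 1 : 𝕜) ≠ 0 := by exact_mod_cast k.succ_ne_zero
    refine (eq_inv_smul_iff₀ hk).2 ?_
    rw [← Nat.cast_succ, Nat.cast_smul_eq_nsmul]
    exact (alternatizeUncurryFin_compContinuousLinearMapCLM_comp_curryLeft α A).symm

theorem contDiffAt_compContinuousLinearMap {P : Type*} [NormedAddCommGroup P] [NormedSpace 𝕜 P]
    {n : ℕ∞ω} {k : ℕ} {α : P → V' [⋀^Fin k]→L[𝕜] W} {A : P → V →L[𝕜] V'} {x : P}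
    (hα : ContDiffAt 𝕜 n α x) (hA : ContDiffAt 𝕜 n A x) :
    ContDiffAt 𝕜 n (fun y => (α y).compContinuousLinearMap (A y)) x :=
  ((contDiff_compContinuousLinearMapCLM (W := W) k).contDiffAt.comp x hA).clm_apply hα

end AlternatingMaps

section Model

variable {E E' F : Type*} [NormedAddCommGroup E] [NormedSpace ℝ E]
  [NormedAddCommGroup E'] [NormedSpace ℝ E'] [NormedAddCommGroup F] [NormedSpace ℝ F]

theorem contDiffAt_curryLeft_apply {n : ℕ∞ω} {k : ℕ} {α : F → E [⋀^Fin (k + 1)]→L[ℝ] ℝ}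
    {v : F → E} {x : F} (hα : ContDiffAt ℝ n α x) (hv : ContDiffAt ℝ n v x) :
    ContDiffAt ℝ n (fun y => (α y).curryLeft (v y)) x :=
  ((curryLeftCLM ℝ E ℝ k).contDiff.contDiffAt.comp x hα).clm_apply hv

theorem lieDerivModel_eq_extDeriv_curryLeft_add {k : ℕ} {v : E → E}
    {α : E → E [⋀^Fin (k + 1)]→L[ℝ] ℝ} {x : E} (hv : DifferentiableAt ℝ v x)
    (hα : DifferentiableAt ℝ α x) :
    lieDerivModel v α x =
      extDeriv (fun y => (α y).curryLeft (v y)) x + (extDeriv α x).curryLeft (v x) := by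
  have hcurry : HasFDerivAt (fun y => (α y).curryLeft) (curryLeftCLM ℝ E ℝ k ∘L fderiv ℝ α x) x :=
    (curryLeftCLM ℝ E ℝ k).hasFDerivAt.comp x hα.hasFDerivAt
  have removeNth_succ_vecCons (i : Fin (k + 1)) (w : Fin (k + 1) → E) :
      i.succ.removeNth (Matrix.vecCons (v x) w) = Matrix.vecCons (v x) (i.removeNth w) := by
    funext j
    refine Fin.cases ?_ (fun j => ?_) j <;> simp [Fin.removeNth]
  ext w
  rw [extDeriv, (hcurry.clm_apply hv.hasFDerivAt).fderiv, lieDerivModel,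
    ContinuousAlternatingMap.fderivCompContinuousLinearMap_eq_alternatizeUncurryFin]
  -- The `v` slot of `dα (v, w)` gives the derivative of `α` along `v`; the other slots cancel
  -- against the terms of `d (ι_v α)` in which `α` is differentiated.
  simp only [extDeriv, ContinuousAlternatingMap.alternatizeUncurryFin_apply,
    ContinuousAlternatingMap.alternatizeUncurryFinCLM_apply, Fin.sum_univ_succ (n := k + 1),
    ContinuousAlternatingMap.add_apply, add_apply, ContinuousLinearMap.comp_apply,
    ContinuousLinearMap.flip_apply, ContinuousLinearMap.postcomp_apply,
    ContinuousLinearMap.coe_id', CompTriple.comp_eq, curryLeftCLM,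
    LinearIsometry.coe_toContinuousLinearMap, ContinuousAlternatingMap.curryLeftLI_apply,
    ContinuousAlternatingMap.curryLeft_apply_apply,
    ContinuousAlternatingMap.compContinuousLinearMapCLM_apply,
    ContinuousAlternatingMap.compContinuousLinearMap_apply, removeNth_succ_vecCons,
    Matrix.cons_val_zero, Matrix.cons_val_succ, Fin.removeNth_zero, Fin.tail_vecCons,
    Fin.coe_ofNat_eq_mod, Nat.zero_mod, Fin.val_succ, pow_zero, pow_succ, one_smul, smul_add,
    Finset.sum_add_distrib, mul_neg, mul_one, neg_smul, Finset.sum_neg_distrib]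
  ring

theorem hasFDerivAt_slice_fst {Φ : E × F → E'} {p : E × F} (hΦ : DifferentiableAt ℝ Φ p) :
    HasFDerivAt (fun y => Φ (y, p.2)) (fderiv ℝ Φ p ∘L .inl ℝ E F) p.1 :=
  hΦ.hasFDerivAt.comp p.1 (hasFDerivAt_prodMk_left p.1 p.2)

theorem hasFDerivAt_slice_snd {Φ : E × F → E'} {p : E × F} (hΦ : DifferentiableAt ℝ Φ p) :
    HasFDerivAt (fun z => Φ (p.1, z)) (fderiv ℝ Φ p ∘L .inr ℝ E F) p.2 :=
  hΦ.hasFDerivAt.comp p.2 (hasFDerivAt_prodMk_right p.1 p.2)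

theorem eventually_differentiableAt_of_contDiffAt {f : E → E'} {x : E} (hf : ContDiffAt ℝ 1 f x) :
    ∀ᶠ y in 𝓝 x, DifferentiableAt ℝ f y :=
  (hf.eventually (by simp)).mono fun _ hy => hy.differentiableAt one_ne_zero

theorem hasFDerivAt_fderiv_slice_fst {Φ : E × F → E'} {y₀ : E} {z₀ : F}
    (hΦ : ContDiffAt ℝ 2 Φ (y₀, z₀)) :
    HasFDerivAt (fun z => fderiv ℝ (fun y => Φ (y, z)) y₀)
      ((ContinuousLinearMap.compL ℝ E (E × F) E').flip (.inl ℝ E F) ∘L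
        fderiv ℝ (fderiv ℝ Φ) (y₀, z₀) ∘L .inr ℝ E F) z₀ := by
  have hD := ((hΦ.fderiv_right (m := 1) le_rfl).differentiableAt one_ne_zero).hasFDerivAt
  refine (((ContinuousLinearMap.compL ℝ E (E × F) E').flip (.inl ℝ E F)).hasFDerivAt.comp z₀
    (hD.comp z₀ (hasFDerivAt_prodMk_right y₀ z₀))).congr_of_eventuallyEq ?_
  filter_upwards [(Continuous.prodMk_right y₀).continuousAt.eventually
    (eventually_differentiableAt_of_contDiffAt (hΦ.of_le one_le_two))] with z hz
  exact (hasFDerivAt_slice_fst hz).fderiv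

theorem hasFDerivAt_fderiv_slice_snd_apply {Φ : E × F → E'} {y₀ : E} {z₀ : F}
    (hΦ : ContDiffAt ℝ 2 Φ (y₀, z₀)) (ξ : F) :
    HasFDerivAt (fun y => fderiv ℝ (fun z => Φ (y, z)) z₀ ξ)
      (ContinuousLinearMap.apply ℝ E' ((0, ξ) : E × F) ∘L
        fderiv ℝ (fderiv ℝ Φ) (y₀, z₀) ∘L .inl ℝ E F) y₀ := by
  have hD := ((hΦ.fderiv_right (m := 1) le_rfl).differentiableAt one_ne_zero).hasFDerivAt
  refine ((ContinuousLinearMap.apply ℝ E' ((0, ξ) : E × F)).hasFDerivAt.comp y₀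
    (hD.comp y₀ (hasFDerivAt_prodMk_left y₀ z₀))).congr_of_eventuallyEq ?_
  filter_upwards [(Continuous.prodMk_left z₀).continuousAt.eventually
    (eventually_differentiableAt_of_contDiffAt (hΦ.of_le one_le_two))] with y hy
  rw [(hasFDerivAt_slice_snd hy).fderiv]
  rfl

theorem fderiv_fderiv_slice_comm {Φ : E × F → E'} {y₀ : E} {z₀ : F}
    (hΦ : ContDiffAt ℝ 2 Φ (y₀, z₀)) (ξ : F) :
    fderiv ℝ (fun z => fderiv ℝ (fun y => Φ (y, z)) y₀) z₀ ξ =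
      fderiv ℝ (fun y => fderiv ℝ (fun z => Φ (y, z)) z₀ ξ) y₀ := by
  rw [(hasFDerivAt_fderiv_slice_fst hΦ).fderiv, (hasFDerivAt_fderiv_slice_snd_apply hΦ ξ).fderiv]
  ext e
  exact hΦ.isSymmSndFDerivAt (by simp) _ _

theorem fderiv_compContinuousLinearMap_fderiv_slice_eq_lieDerivModel {k : ℕ} {Φ : E × F → E}
    {y₀ : E} {z₀ : F} (hΦ : ContDiffAt ℝ 2 Φ (y₀, z₀)) (hid : ∀ᶠ y in 𝓝 y₀, Φ (y, z₀) = y)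
    {α : E → E [⋀^Fin k]→L[ℝ] ℝ} (hα : DifferentiableAt ℝ α y₀) (ξ : F) :
    fderiv ℝ (fun z => (α (Φ (y₀, z))).compContinuousLinearMap
        (fderiv ℝ (fun y => Φ (y, z)) y₀)) z₀ ξ =
      lieDerivModel (fun y => fderiv ℝ (fun z => Φ (y, z)) z₀ ξ) α y₀ := by
  have hΦ₀ : Φ (y₀, z₀) = y₀ := hid.self_of_nhds
  have hDΦ₀ : fderiv ℝ (fun y => Φ (y, z₀)) y₀ = .id ℝ E :=
    (EventuallyEq.fderiv_eq (f := id) hid).trans fderiv_id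
  have hslice : DifferentiableAt ℝ (fun z => Φ (y₀, z)) z₀ :=
    (hasFDerivAt_slice_snd (hΦ.differentiableAt two_ne_zero)).differentiableAt
  have hαΦ : HasFDerivAt (fun z => α (Φ (y₀, z)))
      (fderiv ℝ α y₀ ∘L fderiv ℝ (fun z => Φ (y₀, z)) z₀) z₀ :=
    HasFDerivAt.comp (g := α) z₀ (hΦ₀.symm ▸ hα.hasFDerivAt) hslice.hasFDerivAt
  have hDΦ := (hasFDerivAt_fderiv_slice_fst hΦ).differentiableAt.hasFDerivAt
  rw [(hαΦ.continuousAlternatingMapCompContinuousLinearMap hDΦ).fderiv, lieDerivModel,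
    ← fderiv_fderiv_slice_comm hΦ, hDΦ₀, hΦ₀]
  rfl

end Model

section ParametricIntegral

variable {Y X V : Type*} [TopologicalSpace Y] [TopologicalSpace X]

theorem continuous_slice_snd [TopologicalSpace V] {K : Y × X → V} {U : Set Y}
    (hK : ContinuousOn K (U ×ˢ univ)) {y : Y} (hy : y ∈ U) : Continuous fun g => K (y, g) :=
  hK.comp_continuous (Continuous.prodMk_right y) fun _ => ⟨hy, mem_univ _⟩

variable [CompactSpace X] [NormedAddCommGroup V]

theorem exists_eventually_forall_norm_le {K : Y × X → V} {U : Set Y} (hU : IsOpen U)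
    (hK : ContinuousOn K (U ×ˢ univ)) {y₀ : Y} (hy₀ : y₀ ∈ U) :
    ∃ C, ∀ᶠ y in 𝓝 y₀, ∀ g, ‖K (y, g)‖ ≤ C := by
  obtain ⟨C, hC⟩ := isCompact_univ.exists_bound_of_continuousOn
    (continuous_slice_snd hK hy₀).continuousOn
  refine ⟨C + 1, ?_⟩
  suffices ∀ᶠ y in 𝓝 y₀, ∀ g ∈ univ, ‖K (y, g)‖ < C + 1 from
    this.mono fun y hy g => (hy g (mem_univ g)).le
  refine isCompact_univ.eventually_forall_of_forall_eventually fun g _ => ?_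
  have hcont : ContinuousAt K (y₀, g) :=
    hK.continuousAt ((hU.prod isOpen_univ).mem_nhds ⟨hy₀, mem_univ g⟩)
  exact hcont.norm.eventually_lt_const ((hC g (mem_univ g)).trans_lt (lt_add_one C))

variable [MeasurableSpace X] [OpensMeasurableSpace X] {μ : Measure X} [IsFiniteMeasure μ]

theorem integrable_of_continuous {f : X → V} (hf : Continuous f) : Integrable f μ :=
  hf.integrable_of_hasCompactSupport (.of_compactSpace f)

variable [NormedSpace ℝ V]

theorem continuousOn_integral_of_continuousOn [FirstCountableTopology Y] {K : Y × X → V} {U : Set Y}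
    (hU : IsOpen U) (hK : ContinuousOn K (U ×ˢ univ)) :
    ContinuousOn (fun y => ∫ g, K (y, g) ∂μ) U := by
  intro y₀ hy₀
  obtain ⟨C, hC⟩ := exists_eventually_forall_norm_le hU hK hy₀
  refine (continuousAt_of_dominated (bound := fun _ => C) ?_ ?_ (integrable_const C)
    ?_).continuousWithinAt
  · filter_upwards [hU.mem_nhds hy₀] with y hy
    exact (integrable_of_continuous (continuous_slice_snd hK hy)).aestronglyMeasurable
  · filter_upwards [hC] with y hy
    exact .of_forall hy
  · refine .of_forall fun g => ?_
    exact (hK.continuousAt ((hU.prod isOpen_univ).mem_nhds ⟨hy₀, mem_univ g⟩)).comp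
      (f := fun y => (y, g)) (Continuous.prodMk_left g).continuousAt

variable {E : Type*} [NormedAddCommGroup E] [NormedSpace ℝ E]

theorem hasFDerivAt_integral_of_continuousOn {K : E × X → V} {K' : E × X → E →L[ℝ] V} {U : Set E}
    (hU : IsOpen U) (hK : ContinuousOn K (U ×ˢ univ)) (hK' : ContinuousOn K' (U ×ˢ univ))
    (hd : ∀ y ∈ U, ∀ g, HasFDerivAt (fun z => K (z, g)) (K' (y, g)) y) {y₀ : E} (hy₀ : y₀ ∈ U) :
    HasFDerivAt (fun y => ∫ g, K (y, g) ∂μ) (∫ g, K' (y₀, g) ∂μ) y₀ := by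
  obtain ⟨C, hC⟩ := exists_eventually_forall_norm_le hU hK' hy₀
  refine hasFDerivAt_integral_of_dominated_of_fderiv_le (bound := fun _ => C)
    (inter_mem hC (hU.mem_nhds hy₀)) ?_ (integrable_of_continuous (continuous_slice_snd hK hy₀))
    (integrable_of_continuous (continuous_slice_snd hK' hy₀)).aestronglyMeasurable
    (.of_forall fun g y hy => hy.1 g) (integrable_const C) (.of_forall fun g y hy => hd y hy.2 g)
  filter_upwards [hU.mem_nhds hy₀] with y hy
  exact (integrable_of_continuous (continuous_slice_snd hK hy)).aestronglyMeasurable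

theorem contDiffOn_integral_of_continuousOn_iteratedFDeriv [CompleteSpace V] {K : E × X → V}
    {U : Set E} (hU : IsOpen U) (hsmooth : ∀ g, ContDiffOn ℝ ∞ (fun y => K (y, g)) U)
    (hK : ∀ m : ℕ, ContinuousOn (fun p : E × X => iteratedFDeriv ℝ m (fun y => K (y, p.2)) p.1)
      (U ×ˢ univ)) :
    ContDiffOn ℝ ∞ (fun y => ∫ g, K (y, g) ∂μ) U := by
  suffices HasFTaylorSeriesUpToOn ∞ (fun y => ∫ g, K (y, g) ∂μ)
      (fun y m => ∫ g, iteratedFDeriv ℝ m (fun z => K (z, g)) y ∂μ) U from this.contDiffOn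
  refine ⟨fun y _ => ?_, fun m _ y hy => ?_, fun m _ => continuousOn_integral_of_continuousOn hU
    (hK m)⟩
  · exact ((continuousMultilinearCurryFin0 ℝ E V).toContinuousLinearEquiv.integral_comp_comm
      (μ := μ) fun g => iteratedFDeriv ℝ 0 (fun z => K (z, g)) y).symm
  · let curryLeft := (continuousMultilinearCurryLeftEquiv ℝ
      (fun _ : Fin (m + 1) => E) V).toContinuousLinearEquiv
    have hderiv : ∀ y ∈ U, ∀ g, HasFDerivAt (iteratedFDeriv ℝ m fun z => K (z, g))
        (curryLeft (iteratedFDeriv ℝ (m + 1) (fun z => K (z, g)) y)) y := fun y hy g => by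
      have h := (((hsmooth g).contDiffAt (hU.mem_nhds hy)).differentiableAt_iteratedFDeriv
        (by exact_mod_cast ENat.natCast_lt_top m)).hasFDerivAt
      rwa [fderiv_iteratedFDeriv] at h
    exact ((hasFDerivAt_integral_of_continuousOn hU (hK m)
      (curryLeft.continuous.comp_continuousOn (hK (m + 1))) hderiv hy).congr_fderiv
        (curryLeft.integral_comp_comm (μ := μ) _)).hasFDerivWithinAt

end ParametricIntegral

section Charts

variable {E : Type*} [NormedAddCommGroup E] [NormedSpace ℝ E]
  {M : Type*} [TopologicalSpace M] [ChartedSpace E M]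
  {F : Type*} [NormedAddCommGroup F] [NormedSpace ℝ F]
  {N : Type*} [TopologicalSpace N] [ChartedSpace F N]
  {F' : Type*} [NormedAddCommGroup F'] [NormedSpace ℝ F']
  {P : Type*} [TopologicalSpace P] [ChartedSpace F' P]

theorem diffAt_comp {g : N → P} {f : M → N} {x : M}
    (hg : MDifferentiableAt 𝓘(ℝ, F) 𝓘(ℝ, F') g (f x))
    (hf : MDifferentiableAt 𝓘(ℝ, E) 𝓘(ℝ, F) f x) :
    diffAt (E := E) (E' := F') (g ∘ f) x =
      diffAt (E := F) (E' := F') g (f x) ∘L diffAt (E := E) (E' := F) f x :=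
  mfderiv_comp x hg hf

theorem formAt_pullbackForm {k : ℕ} (f : M → M) (Ω : FormField E M k) (x : M) :
    formAt (pullbackForm f Ω) x =
      (formAt Ω (f x)).compContinuousLinearMap (diffAt (E := E) (E' := E) f x) := rfl

theorem formAt_contract {k : ℕ} (v : VecField E M) (Ω : FormField E M (k + 1)) (x : M) :
    formAt (contract v Ω) x = (formAt Ω x).curryLeft (vecAt v x) := rfl

theorem formField_ext {k : ℕ} {Ω η : FormField E M k} (h : ∀ x, formAt Ω x = formAt η x) :
    Ω = η := funext h

theorem pullbackForm_comp {k : ℕ} {f g : M → M} (hg : MDifferentiable 𝓘(ℝ, E) 𝓘(ℝ, E) g)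
    (hf : MDifferentiable 𝓘(ℝ, E) 𝓘(ℝ, E) f) (Ω : FormField E M k) :
    pullbackForm (g ∘ f) Ω = pullbackForm f (pullbackForm g Ω) :=
  formField_ext fun x => by
    rw [formAt_pullbackForm, diffAt_comp (hg (f x)) (hf x)]
    rfl

theorem pullbackForm_contract {k : ℕ} {f : M → M} {v : VecField E M}
    (hv : ∀ x, mfderiv 𝓘(ℝ, E) 𝓘(ℝ, E) f x (v x) = v (f x)) (Ω : FormField E M (k + 1)) :
    pullbackForm f (contract v Ω) = contract v (pullbackForm f Ω) :=
  formField_ext fun x => by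
    have hvx : diffAt (E := E) (E' := E) f x (vecAt v x) = vecAt v (f x) := hv x
    rw [formAt_pullbackForm, formAt_contract, formAt_contract, formAt_pullbackForm, ← hvx,
      ContinuousAlternatingMap.curryLeft_compContinuousLinearMap]

theorem formField_eq_zero_of_finrank_lt [FiniteDimensional ℝ E] {m : ℕ}
    (hm : Module.finrank ℝ E < m) (Ω : FormField E M m) : Ω = 0 :=
  formField_ext fun x => by
    ext w
    refine (formAt Ω x).toAlternatingMap.map_linearDependent w fun hw => ?_
    simpa using hw.fintype_card_le_finrank.trans_lt hm

/-- The expression of a map in the preferred charts at `x₀` and `x₁`. -/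
def mapInCharts (f : M → N) (x₀ : M) (x₁ : N) : E → F :=
  extChartAt 𝓘(ℝ, F) x₁ ∘ f ∘ (extChartAt 𝓘(ℝ, E) x₀).symm

theorem mapInCharts_extChartAt_self (f : M → N) (x : M) :
    mapInCharts f x (f x) (extChartAt 𝓘(ℝ, E) x x) = extChartAt 𝓘(ℝ, F) (f x) (f x) := by
  simp only [mapInCharts, Function.comp_apply, extChartAt_to_inv]

theorem fderiv_mapInCharts_extChartAt_self {f : M → N} {x : M}
    (hf : MDifferentiableAt 𝓘(ℝ, E) 𝓘(ℝ, F) f x) :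
    fderiv ℝ (mapInCharts f x (f x)) (extChartAt 𝓘(ℝ, E) x x) =
      diffAt (E := E) (E' := F) f x := by
  rw [diffAt, hf.mfderiv]
  simp only [writtenInExtChartAt, modelWithCornersSelf_coe, range_id, fderivWithin_univ]
  rfl

variable [IsManifold 𝓘(ℝ, E) ∞ M]

theorem contMDiffAt_extChartAt_symm {x₀ : M} {y : E} (hy : y ∈ (extChartAt 𝓘(ℝ, E) x₀).target) :
    ContMDiffAt 𝓘(ℝ, E) 𝓘(ℝ, E) ∞ (extChartAt 𝓘(ℝ, E) x₀).symm y :=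
  (contMDiffOn_extChartAt_symm x₀).contMDiffAt (extChartAt_target_mem_nhds' hy)

theorem contMDiffAt_extChartAt_of_mem_source {x₀ x : M}
    (hx : x ∈ (extChartAt 𝓘(ℝ, E) x₀).source) :
    ContMDiffAt 𝓘(ℝ, E) 𝓘(ℝ, E) ∞ (extChartAt 𝓘(ℝ, E) x₀) x :=
  contMDiffAt_extChartAt' (by rwa [← extChartAt_source 𝓘(ℝ, E)])

theorem diffAt_extChartAt_comp_diffAt_symm {x₀ : M} {y : E}
    (hy : y ∈ (extChartAt 𝓘(ℝ, E) x₀).target) :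
    diffAt (E := E) (E' := E) (extChartAt 𝓘(ℝ, E) x₀) ((extChartAt 𝓘(ℝ, E) x₀).symm y) ∘L
      diffAt (E := E) (E' := E) (extChartAt 𝓘(ℝ, E) x₀).symm y = .id ℝ E := by
  have : IsManifold 𝓘(ℝ, E) 1 M := .of_le (n := ∞) (by simp)
  have h := mfderiv_extChartAt_comp_mfderivWithin_extChartAt_symm hy
  rwa [modelWithCornersSelf_coe, range_id, mfderivWithin_univ] at h

theorem diffAt_symm_comp_diffAt_extChartAt {x₀ : M} {y : E}
    (hy : y ∈ (extChartAt 𝓘(ℝ, E) x₀).target) :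
    diffAt (E := E) (E' := E) (extChartAt 𝓘(ℝ, E) x₀).symm y ∘L
      diffAt (E := E) (E' := E) (extChartAt 𝓘(ℝ, E) x₀) ((extChartAt 𝓘(ℝ, E) x₀).symm y) =
        .id ℝ E := by
  have : IsManifold 𝓘(ℝ, E) 1 M := .of_le (n := ∞) (by simp)
  have h := mfderivWithin_extChartAt_symm_comp_mfderiv_extChartAt hy
  rwa [modelWithCornersSelf_coe, range_id, mfderivWithin_univ] at h

theorem diffAt_extChartAt_self (x : M) :
    diffAt (E := E) (E' := E) (extChartAt 𝓘(ℝ, E) x) x = .id ℝ E :=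
  have : IsManifold 𝓘(ℝ, E) 1 M := .of_le (n := ∞) (by simp)
  mfderiv_extChartAt_self

theorem diffAt_extChartAt_symm_self (x : M) :
    diffAt (E := E) (E' := E) (extChartAt 𝓘(ℝ, E) x).symm (extChartAt 𝓘(ℝ, E) x x) =
      .id ℝ E := by
  have h := diffAt_extChartAt_comp_diffAt_symm (mem_extChartAt_target (I := 𝓘(ℝ, E)) x)
  rwa [extChartAt_to_inv, diffAt_extChartAt_self] at h

theorem formFromChart_eq {k : ℕ} (x : M) (α : E [⋀^Fin k]→L[ℝ] ℝ) : formFromChart x α = α := by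
  rw [formFromChart, diffAt_extChartAt_self]
  rfl

theorem formAt_extD {k : ℕ} (Ω : FormField E M k) (x : M) :
    formAt (extD Ω) x = extDeriv (formInChart Ω x) (extChartAt 𝓘(ℝ, E) x x) :=
  formFromChart_eq x _

theorem formAt_lieD {k : ℕ} (v : VecField E M) (Ω : FormField E M k) (x : M) :
    formAt (lieD v Ω) x =
      lieDerivModel (vecInChart v x) (formInChart Ω x) (extChartAt 𝓘(ℝ, E) x x) :=
  formFromChart_eq x _

theorem formInChart_extChartAt_self {k : ℕ} (Ω : FormField E M k) (x : M) :
    formInChart Ω x (extChartAt 𝓘(ℝ, E) x x) = formAt Ω x := by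
  rw [formInChart, diffAt_extChartAt_symm_self, extChartAt_to_inv]
  rfl

theorem eventually_mem_target_and_map_mem_source {f : M → N} {x₀ : M} {x₁ : N} {y : E}
    (hy : y ∈ (extChartAt 𝓘(ℝ, E) x₀).target)
    (hf : ContinuousAt f ((extChartAt 𝓘(ℝ, E) x₀).symm y))
    (hfy : f ((extChartAt 𝓘(ℝ, E) x₀).symm y) ∈ (extChartAt 𝓘(ℝ, F) x₁).source) :
    ∀ᶠ z in 𝓝 y, z ∈ (extChartAt 𝓘(ℝ, E) x₀).target ∧
      f ((extChartAt 𝓘(ℝ, E) x₀).symm z) ∈ (extChartAt 𝓘(ℝ, F) x₁).source :=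
  (eventually_mem_set.2 (extChartAt_target_mem_nhds' hy)).and
    ((hf.comp (contMDiffAt_extChartAt_symm hy).continuousAt).eventually
      (extChartAt_source_mem_nhds' hfy))

variable [IsManifold 𝓘(ℝ, F) ∞ N]

theorem contDiffAt_mapInCharts {f : M → N} {x₀ : M} {x₁ : N} {y : E}
    (hy : y ∈ (extChartAt 𝓘(ℝ, E) x₀).target)
    (hf : ContMDiffAt 𝓘(ℝ, E) 𝓘(ℝ, F) ∞ f ((extChartAt 𝓘(ℝ, E) x₀).symm y))
    (hfy : f ((extChartAt 𝓘(ℝ, E) x₀).symm y) ∈ (extChartAt 𝓘(ℝ, F) x₁).source) :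
    ContDiffAt ℝ ∞ (mapInCharts (E := E) (F := F) f x₀ x₁) y :=
  contMDiffAt_iff_contDiffAt.1 ((contMDiffAt_extChartAt_of_mem_source hfy).comp y
    (hf.comp y (contMDiffAt_extChartAt_symm hy)))

theorem fderiv_mapInCharts {f : M → N} {x₀ : M} {x₁ : N} {y : E}
    (hy : y ∈ (extChartAt 𝓘(ℝ, E) x₀).target)
    (hf : MDifferentiableAt 𝓘(ℝ, E) 𝓘(ℝ, F) f ((extChartAt 𝓘(ℝ, E) x₀).symm y))
    (hfy : f ((extChartAt 𝓘(ℝ, E) x₀).symm y) ∈ (extChartAt 𝓘(ℝ, F) x₁).source) :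
    fderiv ℝ (mapInCharts f x₀ x₁) y =
      diffAt (E := F) (E' := F) (extChartAt 𝓘(ℝ, F) x₁) (f ((extChartAt 𝓘(ℝ, E) x₀).symm y)) ∘L
        diffAt (E := E) (E' := F) f ((extChartAt 𝓘(ℝ, E) x₀).symm y) ∘L
          diffAt (E := E) (E' := E) (extChartAt 𝓘(ℝ, E) x₀).symm y := by
  have hsymm := (contMDiffAt_extChartAt_symm hy).mdifferentiableAt (by simp)
  have hchart := (contMDiffAt_extChartAt_of_mem_source hfy).mdifferentiableAt (by simp)
  rw [← diffAt_comp hf hsymm]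
  exact mfderiv_eq_fderiv.symm.trans (diffAt_comp hchart (hf.comp y hsymm))

theorem formInChart_pullbackForm {k : ℕ} {f : M → M} {x₀ x₁ : M} {y : E}
    (hy : y ∈ (extChartAt 𝓘(ℝ, E) x₀).target)
    (hf : MDifferentiableAt 𝓘(ℝ, E) 𝓘(ℝ, E) f ((extChartAt 𝓘(ℝ, E) x₀).symm y))
    (hfy : f ((extChartAt 𝓘(ℝ, E) x₀).symm y) ∈ (extChartAt 𝓘(ℝ, E) x₁).source)
    (Ω : FormField E M k) :
    formInChart (pullbackForm f Ω) x₀ y =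
      (formInChart Ω x₁ (mapInCharts f x₀ x₁ y)).compContinuousLinearMap
        (fderiv ℝ (mapInCharts f x₀ x₁) y) := by
  have hsymm_chart := diffAt_symm_comp_diffAt_extChartAt ((extChartAt 𝓘(ℝ, E) x₁).map_source hfy)
  have hvalue : (extChartAt 𝓘(ℝ, E) x₁).symm (mapInCharts f x₀ x₁ y) =
      f ((extChartAt 𝓘(ℝ, E) x₀).symm y) := (extChartAt 𝓘(ℝ, E) x₁).left_inv hfy
  rw [(extChartAt 𝓘(ℝ, E) x₁).left_inv hfy] at hsymm_chart
  have hdiff : diffAt (E := E) (E' := E) (extChartAt 𝓘(ℝ, E) x₁).symm (mapInCharts f x₀ x₁ y) ∘L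
      fderiv ℝ (mapInCharts f x₀ x₁) y =
        diffAt (E := E) (E' := E) f ((extChartAt 𝓘(ℝ, E) x₀).symm y) ∘L
          diffAt (E := E) (E' := E) (extChartAt 𝓘(ℝ, E) x₀).symm y := by
    rw [fderiv_mapInCharts hy hf hfy, ← ContinuousLinearMap.comp_assoc]
    exact congrArg (· ∘L _) hsymm_chart
  rw [formInChart, formAt_pullbackForm, formInChart, hvalue]
  exact congrArg (formAt Ω _).compContinuousLinearMap hdiff.symm

end Charts

section FormsInCharts

variable {E : Type*} [NormedAddCommGroup E] [NormedSpace ℝ E]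
  {M : Type*} [TopologicalSpace M] [ChartedSpace E M] [IsManifold 𝓘(ℝ, E) ∞ M]

theorem isSmoothForm_pullbackForm {f : M → M} (hf : ContMDiff 𝓘(ℝ, E) 𝓘(ℝ, E) ∞ f)
    {k : ℕ} {η : FormField E M k} (hη : IsSmoothForm η) : IsSmoothForm (pullbackForm f η) := by
  intro x₀ y hy
  have hfy := mem_extChartAt_source (I := 𝓘(ℝ, E)) (f ((extChartAt 𝓘(ℝ, E) x₀).symm y))
  have hmap := contDiffAt_mapInCharts hy (hf _) hfy
  have hform := (hη (f ((extChartAt 𝓘(ℝ, E) x₀).symm y))).contDiffAt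
    (extChartAt_target_mem_nhds' ((extChartAt 𝓘(ℝ, E) _).map_source hfy))
  refine ((contDiffAt_compContinuousLinearMap (hform.comp y hmap)
    (hmap.fderiv_right (m := ∞) (by simp))).congr_of_eventuallyEq ?_).contDiffWithinAt
  filter_upwards [eventually_mem_target_and_map_mem_source hy hf.continuous.continuousAt hfy]
    with z hz
  exact formInChart_pullbackForm hz.1 (hf.mdifferentiable (by simp) _) hz.2 η

theorem extD_pullbackForm {k : ℕ} {f : M → M} (hf : ContMDiff 𝓘(ℝ, E) 𝓘(ℝ, E) ∞ f)
    {Ω : FormField E M k} (hΩ : IsSmoothForm Ω) :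
    extD (pullbackForm f Ω) = pullbackForm f (extD Ω) := by
  refine formField_ext fun x => ?_
  have hy := mem_extChartAt_target (I := 𝓘(ℝ, E)) x
  have hfy : f ((extChartAt 𝓘(ℝ, E) x).symm (extChartAt 𝓘(ℝ, E) x x)) ∈
      (extChartAt 𝓘(ℝ, E) (f x)).source := by
    rw [extChartAt_to_inv]
    exact mem_extChartAt_source (f x)
  have hval := mapInCharts_extChartAt_self (E := E) (F := E) f x
  have hlocal : formInChart (pullbackForm f Ω) x =ᶠ[𝓝 (extChartAt 𝓘(ℝ, E) x x)]
      fun y => (formInChart Ω (f x) (mapInCharts f x (f x) y)).compContinuousLinearMap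
        (fderiv ℝ (mapInCharts f x (f x)) y) := by
    filter_upwards [eventually_mem_target_and_map_mem_source hy hf.continuous.continuousAt hfy]
      with z hz
    exact formInChart_pullbackForm hz.1 (hf.mdifferentiable (by simp) _) hz.2 Ω
  rw [formAt_extD, hlocal.extDeriv_eq, extDeriv_pullback (r := ∞) (hval ▸ hΩ.differentiableAt (f x))
    (contDiffAt_mapInCharts hy (hf _) hfy) (by simp; norm_cast), formAt_pullbackForm, formAt_extD,
    hval, fderiv_mapInCharts_extChartAt_self (hf.mdifferentiable (by simp) x)]

theorem vecInChart_eq_diffAt_extChartAt (v : VecField E M) {x₀ : M} {y : E}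
    (hy : y ∈ (extChartAt 𝓘(ℝ, E) x₀).target) :
    vecInChart v x₀ y =
      diffAt (E := E) (E' := E) (extChartAt 𝓘(ℝ, E) x₀) ((extChartAt 𝓘(ℝ, E) x₀).symm y)
        (vecAt v ((extChartAt 𝓘(ℝ, E) x₀).symm y)) := by
  have hinv : (diffAt (E := E) (E' := E) (extChartAt 𝓘(ℝ, E) x₀).symm y).inverse =
      diffAt (E := E) (E' := E) (extChartAt 𝓘(ℝ, E) x₀) ((extChartAt 𝓘(ℝ, E) x₀).symm y) :=
    ContinuousLinearMap.inverse_eq (diffAt_symm_comp_diffAt_extChartAt hy)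
      (diffAt_extChartAt_comp_diffAt_symm hy)
  exact congrArg (fun L : E →L[ℝ] E => L (vecAt v ((extChartAt 𝓘(ℝ, E) x₀).symm y))) hinv

theorem vecInChart_extChartAt_self (v : VecField E M) (x : M) :
    vecInChart v x (extChartAt 𝓘(ℝ, E) x x) = vecAt v x := by
  rw [vecInChart_eq_diffAt_extChartAt v (mem_extChartAt_target x), extChartAt_to_inv,
    diffAt_extChartAt_self]
  rfl

theorem formInChart_contract {k : ℕ} (v : VecField E M) (Ω : FormField E M (k + 1)) {x₀ : M}
    {y : E} (hy : y ∈ (extChartAt 𝓘(ℝ, E) x₀).target) :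
    formInChart (contract v Ω) x₀ y = (formInChart Ω x₀ y).curryLeft (vecInChart v x₀ y) := by
  have hv : diffAt (E := E) (E' := E) (extChartAt 𝓘(ℝ, E) x₀).symm y (vecInChart v x₀ y) =
      vecAt v ((extChartAt 𝓘(ℝ, E) x₀).symm y) := by
    rw [vecInChart_eq_diffAt_extChartAt v hy, ← ContinuousLinearMap.comp_apply,
      diffAt_symm_comp_diffAt_extChartAt hy, ContinuousLinearMap.id_apply]
  rw [formInChart, formAt_contract, formInChart,
    ContinuousAlternatingMap.curryLeft_compContinuousLinearMap, hv]

theorem contDiffAt_vecInChart {v : VecField E M} (hv : IsSmoothVecField v)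
    {x₀ : M} {y : E} (hy : y ∈ (extChartAt 𝓘(ℝ, E) x₀).target) :
    ContDiffAt ℝ ∞ (vecInChart v x₀) y := by
  have : IsManifold 𝓘(ℝ, E) 1 M := .of_le (n := ∞) (by simp)
  have hbase {z : E} (hz : z ∈ (extChartAt 𝓘(ℝ, E) x₀).target) :
      (extChartAt 𝓘(ℝ, E) x₀).symm z ∈ (chartAt E x₀).source := by
    rw [← extChartAt_source 𝓘(ℝ, E)]
    exact (extChartAt 𝓘(ℝ, E) x₀).map_target hz
  have hsection := ((trivializationAt E (TangentSpace 𝓘(ℝ, E)) x₀).contMDiffAt_section_iff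
    (hbase hy)).1 (hv ((extChartAt 𝓘(ℝ, E) x₀).symm y))
  refine (contMDiffAt_iff_contDiffAt.1 (hsection.comp y
    (contMDiffAt_extChartAt_symm hy))).congr_of_eventuallyEq ?_
  filter_upwards [extChartAt_target_mem_nhds' hy] with z hz
  have htriv := TangentBundle.continuousLinearMapAt_trivializationAt (I := 𝓘(ℝ, E)) (hbase hz)
  rw [vecInChart_eq_diffAt_extChartAt v hz, diffAt, ← htriv]
  exact Bundle.Trivialization.continuousLinearMapAt_apply_of_mem ℝ _ (hbase hz) _

theorem isSmoothForm_contract {k : ℕ} {v : VecField E M}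
    (hv : IsSmoothVecField v) {Ω : FormField E M (k + 1)} (hΩ : IsSmoothForm Ω) :
    IsSmoothForm (contract v Ω) := fun x₀ =>
  ContDiffOn.congr (fun _ hy => (contDiffAt_curryLeft_apply
    ((hΩ x₀).contDiffAt (extChartAt_target_mem_nhds' hy))
    (contDiffAt_vecInChart hv hy)).contDiffWithinAt) fun _ hy => formInChart_contract v Ω hy

theorem lieD_eq_extD_contract_add {k : ℕ} {v : VecField E M}
    (hv : IsSmoothVecField v) {Ω : FormField E M (k + 1)} (hΩ : IsSmoothForm Ω) :
    lieD v Ω = extD (contract v Ω) + contract v (extD Ω) := by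
  refine formField_ext fun x => ?_
  have hy := mem_extChartAt_target (I := 𝓘(ℝ, E)) x
  have hlocal : formInChart (contract v Ω) x =ᶠ[𝓝 (extChartAt 𝓘(ℝ, E) x x)]
      fun y => (formInChart Ω x y).curryLeft (vecInChart v x y) := by
    filter_upwards [extChartAt_target_mem_nhds' hy] with y hy
    exact formInChart_contract v Ω hy
  calc formAt (lieD v Ω) x
      = extDeriv (fun y => (formInChart Ω x y).curryLeft (vecInChart v x y))
          (extChartAt 𝓘(ℝ, E) x x) + (extDeriv (formInChart Ω x)
            (extChartAt 𝓘(ℝ, E) x x)).curryLeft (vecInChart v x (extChartAt 𝓘(ℝ, E) x x)) := by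
        rw [formAt_lieD, lieDerivModel_eq_extDeriv_curryLeft_add
          ((contDiffAt_vecInChart hv hy).differentiableAt (by simp)) (hΩ.differentiableAt x)]
    _ = formAt (extD (contract v Ω)) x + formAt (contract v (extD Ω)) x := by
        rw [← hlocal.extDeriv_eq, vecInChart_extChartAt_self, formAt_extD, formAt_contract,
          formAt_extD]

end FormsInCharts

section Slices

variable {𝕜 E F V : Type*} [NontriviallyNormedField 𝕜] [NormedAddCommGroup E] [NormedSpace 𝕜 E]
  [NormedAddCommGroup F] [NormedSpace 𝕜 F] [NormedAddCommGroup V] [NormedSpace 𝕜 V]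

theorem contDiffAt_fderiv_slice_fst {m n : ℕ∞ω} {f : E × F → V} {p : E × F}
    (hf : ContDiffAt 𝕜 n f p) (hmn : m + 1 ≤ n) :
    ContDiffAt 𝕜 m (fun q : E × F => fderiv 𝕜 (fun y => f (y, q.2)) q.1) p :=
  ContDiffAt.fderiv (f := fun (q : E × F) y => f (y, q.2))
    (hf.comp (f := fun r : (E × F) × E => (r.2, r.1.2)) (p, p.1) (by fun_prop)) contDiffAt_fst hmn

theorem contDiffAt_iteratedFDeriv_slice_fst {m n : ℕ∞ω} {i : ℕ} {f : E × F → V} {p : E × F}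
    (hf : ContDiffAt 𝕜 n f p) (hmn : m + i ≤ n) :
    ContDiffAt 𝕜 m (fun q : E × F => iteratedFDeriv 𝕜 i (fun y => f (y, q.2)) q.1) p := by
  induction i generalizing m with
  | zero =>
    exact (continuousMultilinearCurryFin0 𝕜 E V).symm.contDiff.contDiffAt.comp p
      (hf.of_le (by simpa using hmn))
  | succ i ih =>
    have hfderiv := contDiffAt_fderiv_slice_fst (m := m)
      (ih (m := m + 1) (by simpa [add_assoc, add_comm, add_left_comm] using hmn)) le_rfl
    exact (continuousMultilinearCurryLeftEquiv 𝕜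
      (fun _ : Fin (i + 1) => E) V).symm.contDiff.contDiffAt.comp p hfderiv

end Slices

section Families

variable {E : Type*} [NormedAddCommGroup E] [NormedSpace ℝ E]
  {M : Type*} [TopologicalSpace M] [ChartedSpace E M]
  {F : Type*} [NormedAddCommGroup F] [NormedSpace ℝ F]
  {G : Type*} [TopologicalSpace G] [ChartedSpace F G]

theorem continuousAt_iteratedFDeriv_slice_fst {V : Type*} [NormedAddCommGroup V] [NormedSpace ℝ V]
    {i : ℕ} {K : E × G → V} {y : E} {g : G}
    (hK : ContDiffAt ℝ i (fun p : E × F => K (p.1, (extChartAt 𝓘(ℝ, F) g).symm p.2))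
      (y, extChartAt 𝓘(ℝ, F) g g)) :
    ContinuousAt (fun p : E × G => iteratedFDeriv ℝ i (fun z => K (z, p.2)) p.1) (y, g) := by
  have hchart : ContinuousAt (fun p : E × G => (p.1, extChartAt 𝓘(ℝ, F) g p.2)) (y, g) :=
    continuousAt_fst.prodMk ((continuousAt_extChartAt g).comp (x := (y, g)) continuousAt_snd)
  have hderiv := (contDiffAt_iteratedFDeriv_slice_fst (m := 0) (i := i) (n := i) hK
    (zero_add _).le).continuousAt
  refine (hderiv.comp (x := (y, g)) hchart).congr ?_
  filter_upwards [continuousAt_snd.eventually (extChartAt_source_mem_nhds (I := 𝓘(ℝ, F)) g)]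
    with p hp
  simp only [Function.comp_apply, (extChartAt 𝓘(ℝ, F) g).left_inv hp]

variable {θ : M × G → M}

theorem contMDiff_act (hθ : ContMDiff (𝓘(ℝ, E).prod 𝓘(ℝ, F)) 𝓘(ℝ, E) ∞ θ) (g : G) :
    ContMDiff 𝓘(ℝ, E) 𝓘(ℝ, E) ∞ (fun x => θ (x, g)) :=
  hθ.comp (contMDiff_id.prodMk contMDiff_const)

theorem contMDiff_orbit (hθ : ContMDiff (𝓘(ℝ, E).prod 𝓘(ℝ, F)) 𝓘(ℝ, E) ∞ θ) (x : M) :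
    ContMDiff 𝓘(ℝ, F) 𝓘(ℝ, E) ∞ (fun g => θ (x, g)) :=
  hθ.comp (contMDiff_const.prodMk contMDiff_id)

/-- The expression of a family of maps `θ (·, g)`, jointly in the point and the parameter, in the
preferred charts at `x₀`, `g₀` and `x₁`. -/
def familyInCharts (θ : M × G → M) (x₀ : M) (g₀ : G) (x₁ : M) (p : E × F) : E :=
  extChartAt 𝓘(ℝ, E) x₁
    (θ ((extChartAt 𝓘(ℝ, E) x₀).symm p.1, (extChartAt 𝓘(ℝ, F) g₀).symm p.2))

variable [IsManifold 𝓘(ℝ, E) ∞ M]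

theorem formInChart_pullbackForm_eq_familyInCharts
    (hθ : ContMDiff (𝓘(ℝ, E).prod 𝓘(ℝ, F)) 𝓘(ℝ, E) ∞ θ) {k : ℕ} (η : FormField E M k)
    {x₀ x₁ : M} {g₀ : G} {p : E × F} (hy : p.1 ∈ (extChartAt 𝓘(ℝ, E) x₀).target)
    (hθp : θ ((extChartAt 𝓘(ℝ, E) x₀).symm p.1, (extChartAt 𝓘(ℝ, F) g₀).symm p.2) ∈
      (extChartAt 𝓘(ℝ, E) x₁).source) :
    formInChart (pullbackForm (fun x => θ (x, (extChartAt 𝓘(ℝ, F) g₀).symm p.2)) η) x₀ p.1 =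
      (formInChart η x₁ (familyInCharts θ x₀ g₀ x₁ p)).compContinuousLinearMap
        (fderiv ℝ (fun y => familyInCharts θ x₀ g₀ x₁ (y, p.2)) p.1) :=
  formInChart_pullbackForm hy ((contMDiff_act hθ _).mdifferentiable (by simp) _) hθp η

variable [IsManifold 𝓘(ℝ, F) ∞ G]

theorem contMDiffAt_comp_extChartAt_symm (hθ : ContMDiff (𝓘(ℝ, E).prod 𝓘(ℝ, F)) 𝓘(ℝ, E) ∞ θ)
    {x₀ : M} {g₀ : G} {p : E × F} (hy : p.1 ∈ (extChartAt 𝓘(ℝ, E) x₀).target)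
    (hz : p.2 ∈ (extChartAt 𝓘(ℝ, F) g₀).target) :
    ContMDiffAt 𝓘(ℝ, E × F) 𝓘(ℝ, E) ∞ (fun p : E × F =>
      θ ((extChartAt 𝓘(ℝ, E) x₀).symm p.1, (extChartAt 𝓘(ℝ, F) g₀).symm p.2)) p :=
  hθ.contMDiffAt.comp p
    (((contMDiffAt_extChartAt_symm hy).comp p contDiff_fst.contMDiff.contMDiffAt).prodMk
      ((contMDiffAt_extChartAt_symm hz).comp p contDiff_snd.contMDiff.contMDiffAt))

theorem contDiffAt_familyInCharts (hθ : ContMDiff (𝓘(ℝ, E).prod 𝓘(ℝ, F)) 𝓘(ℝ, E) ∞ θ)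
    {x₀ x₁ : M} {g₀ : G} {p : E × F} (hy : p.1 ∈ (extChartAt 𝓘(ℝ, E) x₀).target)
    (hz : p.2 ∈ (extChartAt 𝓘(ℝ, F) g₀).target)
    (hθp : θ ((extChartAt 𝓘(ℝ, E) x₀).symm p.1, (extChartAt 𝓘(ℝ, F) g₀).symm p.2) ∈
      (extChartAt 𝓘(ℝ, E) x₁).source) :
    ContDiffAt ℝ ∞ (familyInCharts (E := E) (F := F) θ x₀ g₀ x₁) p :=
  contMDiffAt_iff_contDiffAt.1 ((contMDiffAt_extChartAt_of_mem_source hθp).comp p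
    (contMDiffAt_comp_extChartAt_symm hθ hy hz))

theorem contDiffAt_formInChart_pullbackForm
    (hθ : ContMDiff (𝓘(ℝ, E).prod 𝓘(ℝ, F)) 𝓘(ℝ, E) ∞ θ) {k : ℕ} {η : FormField E M k}
    (hη : IsSmoothForm η) {x₀ : M} {g₀ : G} {p : E × F}
    (hy : p.1 ∈ (extChartAt 𝓘(ℝ, E) x₀).target) (hz : p.2 ∈ (extChartAt 𝓘(ℝ, F) g₀).target) :
    ContDiffAt ℝ ∞ (fun p : E × F => formInChart
      (pullbackForm (fun x => θ (x, (extChartAt 𝓘(ℝ, F) g₀).symm p.2)) η) x₀ p.1) p := by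
  set x₁ := θ ((extChartAt 𝓘(ℝ, E) x₀).symm p.1, (extChartAt 𝓘(ℝ, F) g₀).symm p.2)
  have hθp : x₁ ∈ (extChartAt 𝓘(ℝ, E) x₁).source := mem_extChartAt_source x₁
  have hfamily := contDiffAt_familyInCharts hθ hy hz hθp
  have hform : ContDiffAt ℝ ∞ (formInChart η x₁) (familyInCharts θ x₀ g₀ x₁ p) :=
    (hη x₁).contDiffAt (extChartAt_target_mem_nhds x₁)
  refine (contDiffAt_compContinuousLinearMap (hform.comp p hfamily)
    (contDiffAt_fderiv_slice_fst hfamily (by simp))).congr_of_eventuallyEq ?_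
  filter_upwards [continuousAt_fst.eventually (extChartAt_target_mem_nhds' hy),
    (contMDiffAt_comp_extChartAt_symm hθ hy hz).continuousAt.eventually
      (extChartAt_source_mem_nhds' hθp)] with q hq hθq
  exact formInChart_pullbackForm_eq_familyInCharts hθ η hq hθq

theorem continuousOn_iteratedFDeriv_formInChart_pullbackForm
    (hθ : ContMDiff (𝓘(ℝ, E).prod 𝓘(ℝ, F)) 𝓘(ℝ, E) ∞ θ) {k : ℕ} {η : FormField E M k}
    (hη : IsSmoothForm η) (x₀ : M) (i : ℕ) :
    ContinuousOn (fun p : E × G => iteratedFDeriv ℝ i (fun y =>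
      formInChart (pullbackForm (fun x => θ (x, p.2)) η) x₀ y) p.1)
      ((extChartAt 𝓘(ℝ, E) x₀).target ×ˢ univ) := fun p hp =>
  (continuousAt_iteratedFDeriv_slice_fst
    (K := fun q : E × G => formInChart (pullbackForm (fun x => θ (x, q.2)) η) x₀ q.1)
    ((contDiffAt_formInChart_pullbackForm hθ hη hp.1
      (mem_extChartAt_target p.2)).of_le ENat.LEInfty.out)).continuousWithinAt

theorem continuousOn_formInChart_pullbackForm
    (hθ : ContMDiff (𝓘(ℝ, E).prod 𝓘(ℝ, F)) 𝓘(ℝ, E) ∞ θ) {k : ℕ} {η : FormField E M k}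
    (hη : IsSmoothForm η) (x₀ : M) :
    ContinuousOn (fun p : E × G => formInChart (pullbackForm (fun x => θ (x, p.2)) η) x₀ p.1)
      ((extChartAt 𝓘(ℝ, E) x₀).target ×ˢ univ) :=
  (continuousMultilinearCurryFin0 ℝ E (E [⋀^Fin k]→L[ℝ] ℝ)).continuous.comp_continuousOn
    (continuousOn_iteratedFDeriv_formInChart_pullbackForm hθ hη x₀ 0)

theorem continuousOn_fderiv_formInChart_pullbackForm
    (hθ : ContMDiff (𝓘(ℝ, E).prod 𝓘(ℝ, F)) 𝓘(ℝ, E) ∞ θ) {k : ℕ} {η : FormField E M k}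
    (hη : IsSmoothForm η) (x₀ : M) :
    ContinuousOn (fun p : E × G =>
      fderiv ℝ (formInChart (pullbackForm (fun x => θ (x, p.2)) η) x₀) p.1)
      ((extChartAt 𝓘(ℝ, E) x₀).target ×ˢ univ) := by
  refine ((continuousMultilinearCurryFin1 ℝ E (E [⋀^Fin k]→L[ℝ] ℝ)).continuous.comp_continuousOn
    (continuousOn_iteratedFDeriv_formInChart_pullbackForm hθ hη x₀ 1)).congr fun p _ => ?_
  ext1 e
  simp [iteratedFDeriv_one_apply]

end Families

section Averages

variable {E : Type*} [NormedAddCommGroup E] [NormedSpace ℝ E]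
  {M : Type*} [TopologicalSpace M] [ChartedSpace E M]
  {F : Type*} [NormedAddCommGroup F] [NormedSpace ℝ F]
  {G : Type*} [MeasurableSpace G]

/-- The average `∫ θ_g^* η dμ(g)` of the pullbacks of a form under the maps `θ_g = θ (·, g)`,
computed pointwise. -/
def averageForm (μ : Measure G) (θ : M × G → M) {k : ℕ} (η : FormField E M k) :
    FormField E M k := fun x =>
  (∫ g, formAt (pullbackForm (fun y => θ (y, g)) η) x ∂μ : E [⋀^Fin k]→L[ℝ] ℝ)

theorem formAt_averageForm (μ : Measure G) (θ : M × G → M) {k : ℕ} (η : FormField E M k) (x : M) :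
    formAt (averageForm μ θ η) x = ∫ g, formAt (pullbackForm (fun y => θ (y, g)) η) x ∂μ := rfl

variable {θ : M × G → M} {k : ℕ} {η : FormField E M k}

theorem averageForm_of_isInvariantForm (μ : Measure G) [IsProbabilityMeasure μ]
    (hη : IsInvariantForm θ η) : averageForm μ θ η = η :=
  formField_ext fun x => by
    simp only [formAt_averageForm, hη _, integral_const, probReal_univ, one_smul]

variable [TopologicalSpace G] [ChartedSpace F G] [IsManifold 𝓘(ℝ, E) ∞ M]
  [IsManifold 𝓘(ℝ, F) ∞ G] [CompactSpace G] [OpensMeasurableSpace G]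
  (μ : Measure G) [IsFiniteMeasure μ]

theorem integrable_formAt_pullbackForm
    (hθ : ContMDiff (𝓘(ℝ, E).prod 𝓘(ℝ, F)) 𝓘(ℝ, E) ∞ θ) (hη : IsSmoothForm η) (x : M) :
    Integrable (fun g => formAt (pullbackForm (fun y => θ (y, g)) η) x) μ := by
  have hcont := continuous_slice_snd (continuousOn_formInChart_pullbackForm hθ hη x)
    (mem_extChartAt_target (I := 𝓘(ℝ, E)) x)
  simp only [formInChart_extChartAt_self] at hcont
  exact integrable_of_continuous hcont

theorem compContinuousLinearMap_formAt_averageForm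
    (hθ : ContMDiff (𝓘(ℝ, E).prod 𝓘(ℝ, F)) 𝓘(ℝ, E) ∞ θ) (hη : IsSmoothForm η) (x : M)
    (A : E →L[ℝ] E) :
    (formAt (averageForm μ θ η) x).compContinuousLinearMap A =
      ∫ g, (formAt (pullbackForm (fun y => θ (y, g)) η) x).compContinuousLinearMap A ∂μ :=
  ((ContinuousAlternatingMap.compContinuousLinearMapCLM A).integral_comp_comm
    (integrable_formAt_pullbackForm μ hθ hη x)).symm

theorem formInChart_averageForm
    (hθ : ContMDiff (𝓘(ℝ, E).prod 𝓘(ℝ, F)) 𝓘(ℝ, E) ∞ θ) (hη : IsSmoothForm η) (x₀ : M) :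
    formInChart (averageForm μ θ η) x₀ =
      fun y => ∫ g, formInChart (pullbackForm (fun x => θ (x, g)) η) x₀ y ∂μ :=
  funext fun _ => compContinuousLinearMap_formAt_averageForm μ hθ hη _ _

theorem isSmoothForm_averageForm
    (hθ : ContMDiff (𝓘(ℝ, E).prod 𝓘(ℝ, F)) 𝓘(ℝ, E) ∞ θ) (hη : IsSmoothForm η) :
    IsSmoothForm (averageForm μ θ η) := fun x₀ => by
  rw [formInChart_averageForm μ hθ hη]
  exact contDiffOn_integral_of_continuousOn_iteratedFDeriv
    (K := fun p : E × G => formInChart (pullbackForm (fun x => θ (x, p.2)) η) x₀ p.1)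
    (isOpen_extChartAt_target x₀)
    (fun g => isSmoothForm_pullbackForm (contMDiff_act hθ g) hη x₀)
    (continuousOn_iteratedFDeriv_formInChart_pullbackForm hθ hη x₀)

theorem extD_averageForm
    (hθ : ContMDiff (𝓘(ℝ, E).prod 𝓘(ℝ, F)) 𝓘(ℝ, E) ∞ θ) (hη : IsSmoothForm η) :
    extD (averageForm μ θ η) = averageForm μ θ (extD η) := formField_ext fun x => by
  have hx := mem_extChartAt_target (I := 𝓘(ℝ, E)) x
  have hcont := continuousOn_fderiv_formInChart_pullbackForm hθ hη x
  have hsmooth (g : G) := isSmoothForm_pullbackForm (contMDiff_act hθ g) hη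
  have hderiv := hasFDerivAt_integral_of_continuousOn (μ := μ) (isOpen_extChartAt_target x)
    (continuousOn_formInChart_pullbackForm hθ hη x) hcont
    (fun y hy g => ((hsmooth g x).contDiffAt
      ((isOpen_extChartAt_target x).mem_nhds hy)).differentiableAt (by simp) |>.hasFDerivAt) hx
  calc formAt (extD (averageForm μ θ η)) x
      = ContinuousAlternatingMap.alternatizeUncurryFinCLM ℝ E ℝ (∫ g, fderiv ℝ
          (formInChart (pullbackForm (fun x => θ (x, g)) η) x) (extChartAt 𝓘(ℝ, E) x x) ∂μ) := by
        rw [formAt_extD, formInChart_averageForm μ hθ hη, extDeriv, hderiv.fderiv,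
          ContinuousAlternatingMap.alternatizeUncurryFinCLM_apply]
    _ = ∫ g, formAt (extD (pullbackForm (fun x => θ (x, g)) η)) x ∂μ := by
        rw [← ContinuousLinearMap.integral_comp_comm _
          (integrable_of_continuous (continuous_slice_snd hcont hx))]
        simp only [formAt_extD, extDeriv, ContinuousAlternatingMap.alternatizeUncurryFinCLM_apply]
    _ = formAt (averageForm μ θ (extD η)) x := by
        simp only [extD_pullbackForm (contMDiff_act hθ _) hη, formAt_averageForm]

theorem isInvariantForm_averageForm [Group G] [MeasurableMul G] [μ.IsMulLeftInvariant]
    (hθ : IsSmoothRightAction E F θ) (hη : IsSmoothForm η) :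
    IsInvariantForm θ (averageForm μ θ η) := fun h => formField_ext fun x => by
  have hpullback (g : G) : pullbackForm (fun y => θ (y, h)) (pullbackForm (fun y => θ (y, g)) η) =
      pullbackForm (fun y => θ (y, h * g)) η := by
    simp only [hθ.map_mul]
    exact (pullbackForm_comp ((contMDiff_act hθ.contMDiff g).mdifferentiable (by simp))
      ((contMDiff_act hθ.contMDiff h).mdifferentiable (by simp)) η).symm
  calc formAt (pullbackForm (fun y => θ (y, h)) (averageForm μ θ η)) x
      = ∫ g, formAt (pullbackForm (fun y => θ (y, h)) (pullbackForm (fun y => θ (y, g)) η)) x ∂μ :=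
        compContinuousLinearMap_formAt_averageForm μ hθ.contMDiff hη _ _
    _ = ∫ g, formAt (pullbackForm (fun y => θ (y, h * g)) η) x ∂μ := by simp only [hpullback]
    _ = formAt (averageForm μ θ η) x :=
        integral_mul_left_eq_self (fun g => formAt (pullbackForm (fun y => θ (y, g)) η) x) h

end Averages

theorem lieDerivModel_congr_of_eventuallyEq {E : Type*} [NormedAddCommGroup E] [NormedSpace ℝ E]
    {k : ℕ} {v w : E → E} {y : E} (h : v =ᶠ[𝓝 y] w) (α : E → E [⋀^Fin k]→L[ℝ] ℝ) :
    lieDerivModel v α y = lieDerivModel w α y := by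
  simp only [lieDerivModel, h.eq_of_nhds, h.fderiv_eq]

section Generators

variable {E : Type*} [NormedAddCommGroup E] [NormedSpace ℝ E]
  {M : Type*} [TopologicalSpace M] [ChartedSpace E M]
  {F : Type*} [NormedAddCommGroup F] [NormedSpace ℝ F]
  {G : Type*} [TopologicalSpace G] [ChartedSpace F G] [Group G] {θ : M × G → M}

theorem familyInCharts_extChartAt_one (hθ : IsSmoothRightAction E F θ) {x : M} {y : E}
    (hy : y ∈ (extChartAt 𝓘(ℝ, E) x).target) :
    familyInCharts θ x 1 x (y, extChartAt 𝓘(ℝ, F) (1 : G) 1) = y := by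
  simp only [familyInCharts, extChartAt_to_inv, hθ.map_one, PartialEquiv.right_inv _ hy]

theorem map_extChartAt_symm_one_mem_source (hθ : IsSmoothRightAction E F θ) {x : M} {y : E}
    (hy : y ∈ (extChartAt 𝓘(ℝ, E) x).target) :
    θ ((extChartAt 𝓘(ℝ, E) x).symm y, (extChartAt 𝓘(ℝ, F) (1 : G)).symm
      (extChartAt 𝓘(ℝ, F) (1 : G) 1)) ∈ (extChartAt 𝓘(ℝ, E) x).source := by
  simpa only [extChartAt_to_inv, hθ.map_one] using (extChartAt 𝓘(ℝ, E) x).map_target hy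

variable [IsManifold 𝓘(ℝ, E) ∞ M] [IsManifold 𝓘(ℝ, F) ∞ G]

theorem fderiv_familyInCharts_snd_eq_vecInChart_generator (hθ : IsSmoothRightAction E F θ)
    (ξ : GroupLieAlgebra 𝓘(ℝ, F) G) {x : M} {y : E} (hy : y ∈ (extChartAt 𝓘(ℝ, E) x).target) :
    fderiv ℝ (fun z => familyInCharts θ x 1 x (y, z)) (extChartAt 𝓘(ℝ, F) (1 : G) 1) ξ =
      vecInChart (generator θ ξ) x y := by
  have hchain := fderiv_mapInCharts (mem_extChartAt_target (1 : G))
    ((contMDiff_orbit hθ.contMDiff _).mdifferentiable (by simp) _)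
    (map_extChartAt_symm_one_mem_source hθ hy)
  rw [diffAt_extChartAt_symm_self, extChartAt_to_inv, hθ.map_one] at hchain
  rw [vecInChart_eq_diffAt_extChartAt _ hy]
  exact congr($hchain ξ)

variable {k : ℕ} {H : FormField E M k}

theorem IsInvariantForm.eventually_pullback_familyInCharts_eq (hθ : IsSmoothRightAction E F θ)
    (hinv : IsInvariantForm θ H) {x : M} {y : E} (hy : y ∈ (extChartAt 𝓘(ℝ, E) x).target) :
    ∀ᶠ z in 𝓝 (extChartAt 𝓘(ℝ, F) (1 : G) 1),
      (formInChart H x (familyInCharts θ x 1 x (y, z))).compContinuousLinearMap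
        (fderiv ℝ (fun y => familyInCharts θ x 1 x (y, z)) y) = formInChart H x y := by
  filter_upwards [eventually_mem_target_and_map_mem_source (mem_extChartAt_target (1 : G))
    (contMDiff_orbit hθ.contMDiff _).continuous.continuousAt
    (map_extChartAt_symm_one_mem_source hθ hy)] with z hz
  rw [← formInChart_pullbackForm_eq_familyInCharts hθ.contMDiff H hy hz.2, hinv]

theorem IsInvariantForm.isStrictlyPreserved (hθ : IsSmoothRightAction E F θ)
    (hH : IsSmoothForm H) (hinv : IsInvariantForm θ H) :
    IsStrictlyPreserved F θ H := fun ξ => formField_ext fun x => by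
  set y₀ := extChartAt 𝓘(ℝ, E) x x
  set z₀ := extChartAt 𝓘(ℝ, F) (1 : G) 1
  have hy₀ : y₀ ∈ (extChartAt 𝓘(ℝ, E) x).target := mem_extChartAt_target x
  have htarget : ∀ᶠ y in 𝓝 y₀, y ∈ (extChartAt 𝓘(ℝ, E) x).target := extChartAt_target_mem_nhds x
  have hsmooth : ContDiffAt ℝ 2 (familyInCharts θ x 1 x) (y₀, z₀) :=
    (contDiffAt_familyInCharts hθ.contMDiff hy₀ (mem_extChartAt_target 1)
      (map_extChartAt_symm_one_mem_source hθ hy₀)).of_le ENat.LEInfty.out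
  calc formAt (lieD (generator θ ξ) H) x
      = lieDerivModel (fun y => fderiv ℝ (fun z => familyInCharts θ x 1 x (y, z)) z₀ ξ)
          (formInChart H x) y₀ := by
        rw [formAt_lieD]
        exact lieDerivModel_congr_of_eventuallyEq (htarget.mono fun y hy =>
          (fderiv_familyInCharts_snd_eq_vecInChart_generator hθ ξ hy).symm) _
    _ = fderiv ℝ (fun z => (formInChart H x (familyInCharts θ x 1 x
          (y₀, z))).compContinuousLinearMap
            (fderiv ℝ (fun y => familyInCharts θ x 1 x (y, z)) y₀)) z₀ ξ :=
        (fderiv_compContinuousLinearMap_fderiv_slice_eq_lieDerivModel hsmooth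
          (htarget.mono fun y hy => familyInCharts_extChartAt_one hθ hy)
          (hH.differentiableAt x) ξ).symm
    _ = 0 := by
        rw [EventuallyEq.fderiv_eq (hinv.eventually_pullback_familyInCharts_eq hθ hy₀),
          fderiv_const_apply]
        rfl

end Generators

section Hamiltonian

variable {E : Type*} [NormedAddCommGroup E] [NormedSpace ℝ E]
  {M : Type*} [TopologicalSpace M] [ChartedSpace E M]

theorem exists_extD_eq_of_subsingleton {k : ℕ} (hH : Subsingleton (DeRhamCohomology E M (k + 1)))
    {α : FormField E M (k + 1)} (hα : α ∈ closedForms E M (k + 1)) :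
    ∃ η : FormField E M k, IsSmoothForm η ∧ extD η = α := by
  have hexact : (⟨α, hα⟩ : closedForms E M (k + 1)) ∈
      (exactForms E M (k + 1)).submoduleOf (closedForms E M (k + 1)) :=
    (Submodule.Quotient.mk_eq_zero _).1 (hH.elim _ _)
  exact hexact.2

theorem IsVolumeForm.isPrePlectic {k : ℕ} {Ω : FormField E M (k + 2)} (hΩ : IsVolumeForm Ω) :
    IsPrePlectic Ω := by
  have hE : FiniteDimensional ℝ E := .of_finrank_pos (by rw [hΩ.1]; exact Nat.succ_pos _)
  exact ⟨hΩ.2.1, formField_eq_zero_of_finrank_lt (by rw [hΩ.1]; exact Nat.lt_succ_self _) _⟩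

theorem IsInvariantForm.contract {G : Type*} {θ : M × G → M} {k : ℕ} {Ω : FormField E M (k + 1)}
    (hΩ : IsInvariantForm θ Ω) {v : VecField E M} (hv : IsInvariantVecField θ v) :
    IsInvariantForm θ (contract v Ω) :=
  fun g => by rw [pullbackForm_contract (hv g), hΩ g]

variable [IsManifold 𝓘(ℝ, E) ∞ M]

theorem IsPrePlectic.contract_mem_closedForms {k : ℕ} {Ω : FormField E M (k + 2)}
    (hΩ : IsPrePlectic Ω) {v : VecField E M} (hv : IsSmoothVecField v) (hvΩ : lieD v Ω = 0) :
    contract v Ω ∈ closedForms E M (k + 1) := by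
  have hzero : contract v (0 : FormField E M (k + 3)) = 0 := rfl
  have hcartan := lieD_eq_extD_contract_add hv hΩ.1
  rw [hvΩ, hΩ.2, hzero, add_zero] at hcartan
  exact ⟨isSmoothForm_contract hv hΩ.1, hcartan.symm⟩

variable {F : Type*} [NormedAddCommGroup F] [NormedSpace ℝ F]
  {G : Type*} [TopologicalSpace G] [ChartedSpace F G] [Group G] [LieGroup 𝓘(ℝ, F) ∞ G]
  [CompactSpace G] {θ : M × G → M} {k : ℕ}

theorem exists_isInvariantForm_extD_eq (hθ : IsSmoothRightAction E F θ) {η : FormField E M k}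
    (hη : IsSmoothForm η) (hinv : IsInvariantForm θ (extD η)) :
    ∃ H : FormField E M k, IsSmoothForm H ∧ IsInvariantForm θ H ∧ extD H = extD η := by
  borelize G
  have : IsTopologicalGroup G := topologicalGroup_of_lieGroup 𝓘(ℝ, F) ∞
  let μ : Measure G := Measure.haarMeasure ⊤
  have : IsProbabilityMeasure μ := ⟨Measure.haarMeasure_self⟩
  refine ⟨averageForm μ θ η, isSmoothForm_averageForm μ hθ.contMDiff hη,
    isInvariantForm_averageForm μ hθ hη, ?_⟩
  rw [extD_averageForm μ hθ.contMDiff hη, averageForm_of_isInvariantForm μ hinv]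

theorem exists_isHamiltonianVecField_isInvariantForm (hθ : IsSmoothRightAction E F θ)
    {Ω : FormField E M (k + 2)} (hΩ : IsInvariantForm θ Ω) (hpre : IsPrePlectic Ω)
    {v : VecField E M} (hv : IsSmoothVecField v) (hvG : IsInvariantVecField θ v)
    (hvΩ : lieD v Ω = 0) (hH : Subsingleton (DeRhamCohomology E M (k + 1))) :
    ∃ H : FormField E M k, IsHamiltonianVecField Ω H v ∧
      IsInvariantForm θ H ∧ IsStrictlyPreserved F θ H := by
  have hinv : IsInvariantForm θ (-contract v Ω) := fun g => congrArg Neg.neg (hΩ.contract hvG g)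
  obtain ⟨η, hη, hdη⟩ := exists_extD_eq_of_subsingleton hH
    (neg_mem (hpre.contract_mem_closedForms hv hvΩ))
  obtain ⟨H, hHsmooth, hHinv, hdH⟩ := exists_isInvariantForm_extD_eq hθ hη (hdη ▸ hinv)
  exact ⟨H, ⟨hHsmooth, hv, hdH.trans hdη⟩, hHinv, hHinv.isStrictlyPreserved hθ hHsmooth⟩

end Hamiltonian

end Multisymplectic

end

open Multisymplectic in
theorem mainTheorem11_general
    {E : Type*} [NormedAddCommGroup E] [NormedSpace ℝ E]
    {M : Type*} [TopologicalSpace M] [ChartedSpace E M] [IsManifold 𝓘(ℝ, E) ∞ M]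
    {F : Type*} [NormedAddCommGroup F] [NormedSpace ℝ F]
    {G : Type*} [TopologicalSpace G] [ChartedSpace F G] [Group G]
    [LieGroup 𝓘(ℝ, F) ∞ G] [CompactSpace G]
    (θ : M × G → M) (hθ : IsSmoothRightAction E F θ)
    (k : ℕ) (Ω : FormField E M (k + 2)) (hΩ : IsInvariantForm θ Ω)
    (v : VecField E M) (hv : IsSmoothVecField v) (hvG : IsInvariantVecField θ v)
    (hvΩ : lieD v Ω = 0)
    (hH : Subsingleton (DeRhamCohomology E M (k + 1))) :
    (IsPrePlectic Ω →
      ∃ H : FormField E M k, IsHamiltonianVecField Ω H v ∧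
        IsInvariantForm θ H ∧ IsStrictlyPreserved F θ H) ∧
    (IsVolumeForm Ω →
      ∃ H : FormField E M k, IsHamiltonianVecField Ω H v ∧
        IsInvariantForm θ H ∧ IsStrictlyPreserved F θ H) :=
  have hamiltonianForm (hpre : IsPrePlectic Ω) :=
    exists_isHamiltonianVecField_isInvariantForm hθ hΩ hpre hv hvG hvΩ hH
  ⟨hamiltonianForm, fun hvol => hamiltonianForm hvol.isPrePlectic⟩

open Multisymplectic in
/-- Here `n = k + 1`, so that `n ≥ 1`. -/
theorem mainTheorem11
    {E : Type*} [NormedAddCommGroup E] [NormedSpace ℝ E] [FiniteDimensional ℝ E]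
    {M : Type*} [TopologicalSpace M] [T2Space M] [SecondCountableTopology M]
    [ChartedSpace E M] [IsManifold 𝓘(ℝ, E) ∞ M]
    {F : Type*} [NormedAddCommGroup F] [NormedSpace ℝ F] [FiniteDimensional ℝ F]
    {G : Type*} [TopologicalSpace G] [T2Space G] [ChartedSpace F G] [Group G]
    [LieGroup 𝓘(ℝ, F) ∞ G] [CompactSpace G] [ConnectedSpace G]
    (θ : M × G → M) (hθ : IsSmoothRightAction E F θ)
    (k : ℕ) (Ω : FormField E M (k + 2)) (hΩ : IsInvariantForm θ Ω)
    (v : VecField E M) (hv : IsSmoothVecField v) (hvG : IsInvariantVecField θ v)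
    (hvΩ : lieD v Ω = 0)
    (hH : Subsingleton (DeRhamCohomology E M (k + 1))) :
    (IsPrePlectic Ω →
      ∃ H : FormField E M k, IsHamiltonianVecField Ω H v ∧
        IsInvariantForm θ H ∧ IsStrictlyPreserved F θ H) ∧
    (IsVolumeForm Ω →
      ∃ H : FormField E M k, IsHamiltonianVecField Ω H v ∧
        IsInvariantForm θ H ∧ IsStrictlyPreserved F θ H) :=
  mainTheorem11_general θ hθ k Ω hΩ v hv hvG hvΩ hH
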